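/- **Setting.** Let the action space $\mathbb U$ and the observation space $\mathbb Y$ be separable metrizable spaces whose Borel $\sigma$-algebras are standard Borel (for instance, Borel subsets of $\mathbb R^n$ and $\mathbb R^m$), the same for all decision makers $i\in\mathbb N$, and let $Q$ be a Borel probability measure on $\mathbb Y$ (the common reference law of the observations). A (relaxed) policy of a decision maker is a probability measure on $\mathbb U\times\mathbb Y$ of the form $\gamma(du\mid y)\,Q(dy)$ with $\gamma$ a stochastic kernel from $\mathbb Y$ to $\mathbb U$. The set $\Gamma$ of all policies carries the subspace topology of the weak convergence topology on $\mathcal P(\mathbb U\times\mathbb Y)$ (the Young measure topology) and its Borel $\sigma$-algebra $\mathcal B(\Gamma)$. Randomized policies are the elements of $L:=\mathcal P\big(\prod_{i\in\mathbb N}\Gamma\big)$ (product $\sigma$-algebra). Let $L_{\mathrm{EX}}$ be the set of infinitely-exchangeable randomized policies, i.e. of all $P\in L$ such that for all $N\in\mathbb N$, all permutations $\sigma$ of $\{1,\dots,N\}$ and all $A_1,\dots,A_N\in\mathcal B(\Gamma)$, $$P(\gamma^1\in A_1,\dots,\gamma^N\in A_N)=P(\gamma^{\sigma(1)}\in A_1,\dots,\gamma^{\sigma(N)}\in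 A_N).$$ Let $L_{\mathrm{CO,SYM}}$ be the set of all $P\in L$ for which there are $\eta\in\mathcal P([0,1])$ and a stochastic kernel $\tilde P(\cdot\mid z)$ from $[0,1]$ to $\Gamma$ such that for all $A_1,A_2,\ldots\in\mathcal B(\Gamma)$, $$P(\gamma^1\in A_1,\gamma^2\in A_2,\dots)=\int_{[0,1]}\prod_{i\in\mathbb N}\tilde P(A_i\mid z)\,\eta(dz).\qquad(*)$$ **Theorem (de Finetti theorem for team policies).** Every infinitely-exchangeable randomized policy $P\in L_{\mathrm{EX}}$ belongs to $L_{\mathrm{CO,SYM}}$. That is, it is a mixture of i.i.d. identical randomized policies over a $[0,1]$-valued common randomness $Z$: there are, on some probability space $(\Omega,\mathcal F,\mu)$, a $[0,1]$-valued random variable $Z$ and random policies $(g^1,g^2,\dots)$ with joint law $P$, and a stochastic kernel $\tilde P(\cdot\mid z)$ from $[0,1]$ to $\Gamma$, such that, with $\eta$ the law of $Z$, for all Borel $B\subseteq[0,1]$ and all $A_1,A_2,\ldots\in\mathcal B(\Gamma)$, $$\mu(Z\in B,\ g^1\in A_1,\ g^2\in A_2,\dots)=\int_B\prod_{i\in\mathbb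 N}\tilde P(A_i\mid z)\,\eta(dz)$$ (for $B=[0,1]$ this is $(*)$). -/

import Mathlib

open MeasureTheory ProbabilityTheory Set
open scoped ENNReal

universe u v

/-- The set `R` of all joint laws `P` on `U × Y` of the form
`P(du, dy) = κ(du | y) Q(dy)`, where `κ` is a stochastic kernel from `Y` to `U`. -/
def youngMeasures (U : Type*) {Y : Type*} [MeasurableSpace U] [MeasurableSpace Y]
    (Q : ProbabilityMeasure Y) : Set (ProbabilityMeasure (U × Y)) :=
  {P | ∃ κ : Kernel Y U, IsMarkovKernel κ ∧
    (P : Measure (U × Y)) = ((Q : Measure Y) ⊗ₘ κ).map Prod.swap}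

/-- The space `Γ` of (relaxed) policies of one decision maker with action space `U`, observation
space `Y` and reference observation law `Q`: a policy is identified with its Young measure. -/
def Policy (U : Type*) {Y : Type*} [MeasurableSpace U] [MeasurableSpace Y]
    (Q : ProbabilityMeasure Y) : Type _ :=
  {P : ProbabilityMeasure (U × Y) // P ∈ youngMeasures U Q}

section PolicyTopology

variable {U Y : Type*} [TopologicalSpace U] [MeasurableSpace U] [BorelSpace U]
  [SecondCountableTopology U] [TopologicalSpace Y] [MeasurableSpace Y] [BorelSpace Y]

/-- Policies carry the subspace topology of the topology of weak convergence of probability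
measures on `U × Y`. -/
noncomputable instance Policy.instTopologicalSpace (Q : ProbabilityMeasure Y) :
    TopologicalSpace (Policy U Q) :=
  TopologicalSpace.induced (fun γ : Policy U Q => γ.1) inferInstance

/-- Policies carry the Borel `σ`-algebra of their topology. -/
noncomputable instance Policy.instMeasurableSpace (Q : ProbabilityMeasure Y) :
    MeasurableSpace (Policy U Q) :=
  borel (Policy U Q)

instance Policy.instBorelSpace (Q : ProbabilityMeasure Y) : BorelSpace (Policy U Q) :=
  ⟨rfl⟩

end PolicyTopology

/-- An infinite product of numbers in `[0, 1]` always converges (unconditionally), so that the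
`∏'` used below is a genuine infinite product. -/
theorem multipliable_of_forall_le_one (f : ℕ → ℝ≥0∞) (hf : ∀ i, f i ≤ 1) : Multipliable f :=
  ⟨_, tendsto_atTop_iInf fun _ _ hst =>
    Finset.prod_le_prod_of_subset_of_le_one' hst fun i _ _ => hf i⟩

section RandomizedPolicies

variable (U : Type*) {Y : Type*} [TopologicalSpace U] [MeasurableSpace U] [BorelSpace U]
  [SecondCountableTopology U] [TopologicalSpace Y] [MeasurableSpace Y] [BorelSpace Y]

/-- The set `L` of randomized policies of a team with decision makers indexed by `ℕ`: probability
measures on the product `∏ i, Γ` with its product `σ`-algebra. -/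
abbrev RandomizedPolicy (Q : ProbabilityMeasure Y) : Type _ :=
  ProbabilityMeasure (ℕ → Policy U Q)

/-- The set `L_EX` of infinitely-exchangeable randomized policies. -/
def exchangeablePolicies (Q : ProbabilityMeasure Y) : Set (RandomizedPolicy U Q) :=
  {P | ∀ (N : ℕ) (σ : Equiv.Perm (Fin N)) (A : Fin N → Set (Policy U Q)),
    (∀ i, MeasurableSet (A i)) →
      (P : Measure (ℕ → Policy U Q)) {γ | ∀ i : Fin N, γ i ∈ A i} =
        (P : Measure (ℕ → Policy U Q)) {γ | ∀ i : Fin N, γ (σ i) ∈ A i}}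

/-- The set `L_{CO,SYM}` of identical randomized policies induced by a common randomness `z` with
law `η` on `[0, 1]` and by individual randomness: given `z`, the individual policies are
independent, all with the same law `κ(· | z)`. -/
def commonSymmetricPolicies (Q : ProbabilityMeasure Y) : Set (RandomizedPolicy U Q) :=
  {P | ∃ (η : ProbabilityMeasure (Icc (0 : ℝ) 1)) (κ : Kernel (Icc (0 : ℝ) 1) (Policy U Q)),
    IsMarkovKernel κ ∧ ∀ A : ℕ → Set (Policy U Q), (∀ i, MeasurableSet (A i)) →
      (P : Measure (ℕ → Policy U Q)) {γ | ∀ i, γ i ∈ A i} =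
        ∫⁻ z, ∏' i, κ z (A i) ∂(η : Measure (Icc (0 : ℝ) 1))}

end RandomizedPolicies

/-! The policy space is standard Borel: laws on `U × Y` form a standard Borel space, and the
policies among them are cut out by the measurable condition that the second marginal is `Q`. The
rest is de Finetti's theorem in a standard Borel space.

An exchangeable law is invariant under every injective reindexing
(`map_reindex_eq_of_exchangeable`). Let `headKernel` be the conditional law of the first term given
the tail. An `L²` argument shows that it does not change, almost surely, when the tail is shifted
(`headKernel_seqTail`), so the first `n` terms are i.i.d. with this law given what follows them
(`setLIntegral_seqTail_iterate`). Both the odd and the even subsequence again have law `P`: the odd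
one serves as common randomness, coded by a point of `[0, 1]`, and the even one as the policies.
Neither a limiting empirical measure nor a tail `σ`-algebra is needed. -/

/-! ### Weak convergence and the evaluation `σ`-algebra. -/

section WeakTopology

open Filter Topology TopologicalSpace

/-- On a second countable metrizable space, the Borel `σ`-algebra of the topology of weak
convergence is the `σ`-algebra generated by the evaluations. -/
theorem probabilityMeasure_borelSpace {X : Type*} [TopologicalSpace X] [MetrizableSpace X]
    [SecondCountableTopology X] [MeasurableSpace X] [BorelSpace X] :
    BorelSpace (ProbabilityMeasure X) := by
  refine ⟨le_antisymm ?_ ?_⟩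
  · have hid : @Measurable _ _ (borel (ProbabilityMeasure X)) _
        (fun μ : ProbabilityMeasure X => (μ : Measure X)) := by
      let : MeasurableSpace (ProbabilityMeasure X) := borel (ProbabilityMeasure X)
      have : BorelSpace (ProbabilityMeasure X) := ⟨rfl⟩
      refine Measurable.measure_of_isPiSystem_of_isProbabilityMeasure
        (BorelSpace.measurable_eq (α := X)) isPiSystem_isOpen fun G hG => ?_
      refine LowerSemicontinuous.measurable (lowerSemicontinuous_iff_le_liminf.2 fun μ => ?_)
      exact ProbabilityMeasure.le_liminf_measure_open_of_tendsto tendsto_id hG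
    exact hid.comap_le
  · refine MeasurableSpace.generateFrom_le fun G (hG : IsOpen G) => ?_
    -- Closing a countable basis under finite intersections gives a countable π-system on which
    -- convergence of masses already implies weak convergence.
    let S : Set (Set X) := (fun f => ⋂₀ f) '' {f : Set (Set X) | f.Finite ∧ f ⊆ countableBasis X}
    have hScount : S.Countable :=
      (countable_ofPred_finite_subset (countable_countableBasis X)).image _
    have hSopen : ∀ s ∈ S, IsOpen s := by
      rintro _ ⟨f, ⟨hf, hfb⟩, rfl⟩
      exact hf.isOpen_sInter fun s hs => isOpen_of_mem_countableBasis (hfb hs)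
    have hSpi : IsPiSystem S := by
      rintro _ ⟨f, ⟨hf, hfb⟩, rfl⟩ _ ⟨g, ⟨hg, hgb⟩, rfl⟩ -
      exact ⟨f ∪ g, ⟨hf.union hg, union_subset hfb hgb⟩, sInter_union f g⟩
    have hSbasis : ∀ u : Set X, IsOpen u → ∀ x ∈ u, ∃ s ∈ S, s ∈ 𝓝 x ∧ s ⊆ u := by
      intro u hu x hx
      obtain ⟨v, hv, hxv, hvu⟩ := (isBasis_countableBasis X).exists_subset_of_mem_open hx hu
      exact ⟨v, ⟨{v}, by simpa using hv, by simp⟩,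
        (isOpen_of_mem_countableBasis hv).mem_nhds hxv, hvu⟩
    have : Countable S := hScount.to_subtype
    let Φ : ProbabilityMeasure X → S → NNReal := fun μ s => μ s
    have hΦ : Measurable Φ := by
      refine measurable_pi_iff.2 fun s => Measurable.ennreal_toNNReal ?_
      exact (Measure.measurable_coe (hSopen _ s.2).measurableSet).comp measurable_subtype_coe
    have hnhds : ∀ μ : ProbabilityMeasure X, comap Φ (𝓝 (Φ μ)) ≤ 𝓝 μ := by
      intro μ
      refine hSpi.tendsto_probabilityMeasure_of_tendsto_of_mem (μ := id)
        (l := comap Φ (𝓝 (Φ μ))) (fun s hs => (hSopen s hs).measurableSet) hSbasis fun s hs => ?_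
      exact (tendsto_pi_nhds.1 (tendsto_comap (f := Φ) (x := 𝓝 (Φ μ)))) ⟨s, hs⟩
    -- The topology induced by `Φ` is at least as fine as the weak one, and its open sets are
    -- preimages under a measurable map into a countable product.
    have hG' : IsOpen[TopologicalSpace.induced Φ inferInstance] G := by
      refine (@isOpen_iff_mem_nhds _ (TopologicalSpace.induced Φ inferInstance) G).2 fun μ hμ => ?_
      rw [nhds_induced]
      exact hnhds μ (hG.mem_nhds hμ)
    obtain ⟨O, hO, rfl⟩ := isOpen_induced_iff.1 hG'
    exact hΦ hO.measurableSet

end WeakTopology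

/-! ### The space of policies is standard Borel. -/

section StandardBorel

open Filter Topology

theorem MeasurableEmbedding.standardBorelSpace {X Z : Type*} [MeasurableSpace X]
    [MeasurableSpace Z] [StandardBorelSpace Z] {f : X → Z} (hf : MeasurableEmbedding f) :
    StandardBorelSpace X := by
  obtain ⟨τ, hτ, hpol⟩ := hf.measurableSet_range.standardBorel.polish
  let e : X ≃ᵐ range f := hf.equivRange
  let : TopologicalSpace X := TopologicalSpace.induced e τ
  refine ⟨⟨inferInstance, ⟨?_⟩, e.toEquiv.polishSpace_induced⟩⟩
  rw [borel_comap, ← BorelSpace.measurable_eq, e.measurableEmbedding.comap_eq]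

theorem isRatStieltjesPoint_cdf (μ : Measure ℝ) :
    IsRatStieltjesPoint (fun (f : ℚ → ℝ) q => f q) (fun q => cdf μ q) where
  mono _ _ h := monotone_cdf μ (by exact_mod_cast h)
  tendsto_atTop_one := (tendsto_cdf_atTop μ).comp (tendsto_ratCast_atTop_iff.2 tendsto_id)
  tendsto_atBot_zero := (tendsto_cdf_atBot μ).comp (tendsto_ratCast_atBot_iff.2 tendsto_id)
  iInf_rat_gt_eq t := by
    refine Eq.trans ?_ ((cdf μ).iInf_rat_gt_eq t)
    refine Equiv.iInf_congr (Equiv.subtypeEquivRight fun r => ?_) fun r => rfl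
    simp

/-- By right continuity a law on `ℝ` is determined by its distribution function on `ℚ`. The
functions that arise form a measurable set, and Stieltjes measures provide the measurable inverse.
-/
theorem measurableEmbedding_cdf :
    MeasurableEmbedding fun (μ : ProbabilityMeasure ℝ) (q : ℚ) => cdf (μ : Measure ℝ) q := by
  have hid : Measurable fun (f : ℚ → ℝ) (q : ℚ) => f q := measurable_id
  let F := (isMeasurableRatCDF_toRatCDF hid).stieltjesFunction
  have hcdf : ∀ f, cdf (F f).measure = F f := fun f =>
    cdf_measure_stieltjesFunction _
      ((isMeasurableRatCDF_toRatCDF hid).tendsto_stieltjesFunction_atBot f)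
      ((isMeasurableRatCDF_toRatCDF hid).tendsto_stieltjesFunction_atTop f)
  have hF : ∀ f, IsRatStieltjesPoint (fun (f : ℚ → ℝ) q => f q) f → ∀ q : ℚ, F f q = f q :=
    fun f hf q => ((isMeasurableRatCDF_toRatCDF hid).stieltjesFunction_eq f q).trans
      (toRatCDF_of_isRatStieltjesPoint hf q)
  let g : (ℚ → ℝ) → ProbabilityMeasure ℝ := fun f =>
    ⟨(F f).measure,
      (isMeasurableRatCDF_toRatCDF hid).instIsProbabilityMeasure_stieltjesFunction f⟩
  refine MeasurableEmbedding.of_measurable_inverse (g := g) ?_ ?_ ?_ ?_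
  · refine measurable_pi_iff.2 fun q => ?_
    have : ∀ μ : ProbabilityMeasure ℝ, cdf (μ : Measure ℝ) q = (μ : Measure ℝ).real (Iic (q : ℝ)) :=
      fun μ => cdf_eq_real _ _
    simp_rw [this]
    exact ((Measure.measurable_coe measurableSet_Iic).comp measurable_subtype_coe).ennreal_toReal
  · convert! measurableSet_isRatStieltjesPoint hid using 1
    ext f
    refine ⟨?_, fun hf => ⟨g f, ?_⟩⟩
    · rintro ⟨μ, rfl⟩
      exact isRatStieltjesPoint_cdf _
    · ext q
      exact (congrArg (fun G : StieltjesFunction ℝ => G q) (hcdf f)).trans (hF f hf q)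
  · exact ((isMeasurableRatCDF_toRatCDF hid).measurable_measure_stieltjesFunction).subtype_mk
  · intro μ
    have hμ : (F fun q => cdf (μ : Measure ℝ) q).measure = μ := by
      have : IsProbabilityMeasure (F fun q => cdf (μ : Measure ℝ) q).measure := (g _).2
      refine Measure.eq_of_cdf _ _ ((hcdf _).trans (StieltjesFunction.ext fun x => ?_))
      rw [← StieltjesFunction.iInf_rat_gt_eq, ← StieltjesFunction.iInf_rat_gt_eq]
      exact iInf_congr fun r => hF _ (isRatStieltjesPoint_cdf _) r
    exact Subtype.ext hμ

theorem measurable_probabilityMeasure_map {X Z : Type*} [MeasurableSpace X] [MeasurableSpace Z]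
    {f : X → Z} (hf : Measurable f) :
    Measurable fun μ : ProbabilityMeasure X => μ.map hf.aemeasurable :=
  ((Measure.measurable_map f hf).comp measurable_subtype_coe).subtype_mk

/-- Pushing forward along a measurable embedding `X → ℝ` identifies laws on `X` with the laws on `ℝ`
that give no mass to the complement of its range. -/
theorem probabilityMeasure_standardBorelSpace (X : Type*) [MeasurableSpace X]
    [StandardBorelSpace X] [Nonempty X] : StandardBorelSpace (ProbabilityMeasure X) := by
  have he := measurableEmbedding_embeddingReal X
  have hinv : Measurable he.invFun := he.measurable_invFun
  have hemb : MeasurableEmbedding fun μ : ProbabilityMeasure X =>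
      μ.map he.measurable.aemeasurable := by
    refine MeasurableEmbedding.of_measurable_inverse
      (g := fun ν => ν.map hinv.aemeasurable) (measurable_probabilityMeasure_map he.measurable) ?_ (measurable_probabilityMeasure_map hinv) ?_
    · have : MeasurableSet {ν : ProbabilityMeasure ℝ |
          (ν : Measure ℝ) (range (embeddingReal X))ᶜ = 0} :=
        ((Measure.measurable_coe he.measurableSet_range.compl).comp measurable_subtype_coe)
          (measurableSet_singleton 0)
      convert! this using 1
      ext ν
      refine ⟨?_, fun hν => ⟨ν.map hinv.aemeasurable, ?_⟩⟩
      · rintro ⟨μ, rfl⟩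
        simp [Measure.map_apply he.measurable he.measurableSet_range.compl]
      · refine Subtype.ext ?_
        change ((ν : Measure ℝ).map he.invFun).map (embeddingReal X) = ν
        rw [Measure.map_map he.measurable hinv]
        refine (Measure.map_congr (g := id) ?_).trans Measure.map_id
        have hae : ∀ᵐ x ∂(ν : Measure ℝ), x ∈ range (embeddingReal X) := hν
        filter_upwards [hae]
        rintro _ ⟨y, rfl⟩
        simp [he.leftInverse_invFun y]
    · intro μ
      refine Subtype.ext ?_
      change ((μ : Measure X).map (embeddingReal X)).map he.invFun = μ
      rw [Measure.map_map hinv he.measurable, he.leftInverse_invFun.id, Measure.map_id]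
  exact (measurableEmbedding_cdf.comp hemb).standardBorelSpace

/-- A law on `U × Y` is a policy if and only if its second marginal is the reference law. -/
theorem mem_youngMeasures_iff {U Y : Type*} [MeasurableSpace U] [StandardBorelSpace U]
    [MeasurableSpace Y] (Q : ProbabilityMeasure Y) (P : ProbabilityMeasure (U × Y)) :
    P ∈ youngMeasures U Q ↔ P.map measurable_snd.aemeasurable = Q := by
  constructor
  · rintro ⟨κ, hκ, hP⟩
    refine Subtype.ext ?_
    change (P : Measure (U × Y)).map Prod.snd = Q
    rw [hP, Measure.map_map measurable_snd measurable_swap]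
    exact Measure.fst_compProd _ κ
  · intro h
    have h' : (P : Measure (U × Y)).map Prod.snd = Q := congrArg Subtype.val h
    have : Nonempty U := P.nonempty.map Prod.fst
    let ρ : Measure (Y × U) := (P : Measure (U × Y)).map Prod.swap
    have : IsProbabilityMeasure ρ := Measure.isProbabilityMeasure_map measurable_swap.aemeasurable
    have hρ : ρ.fst = Q := by
      rw [← h', Measure.fst, Measure.map_map measurable_fst measurable_swap]
      rfl
    refine ⟨ρ.condKernel, inferInstance, ?_⟩
    rw [← hρ, ρ.disintegrate, Measure.map_map measurable_swap measurable_swap]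
    simp

/-- By disintegration, the policies are the preimage of the measurable set `{Q}` under the second
marginal map. -/
theorem policy_standardBorelSpace {U Y : Type*}
    [TopologicalSpace U] [TopologicalSpace.MetrizableSpace U] [SecondCountableTopology U]
    [MeasurableSpace U] [BorelSpace U] [StandardBorelSpace U]
    [TopologicalSpace Y] [TopologicalSpace.MetrizableSpace Y] [SecondCountableTopology Y]
    [MeasurableSpace Y] [BorelSpace Y] [StandardBorelSpace Y]
    (Q : ProbabilityMeasure Y) [hne : Nonempty (Policy U Q)] :
    StandardBorelSpace (Policy U Q) := by
  have : Nonempty (U × Y) := hne.some.1.nonempty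
  have : Nonempty Y := Q.nonempty
  have := probabilityMeasure_standardBorelSpace (U × Y)
  have := probabilityMeasure_standardBorelSpace Y
  have := probabilityMeasure_borelSpace (X := U × Y)
  have hcomap : Policy.instMeasurableSpace (U := U) Q =
      MeasurableSpace.comap (fun γ : Policy U Q => γ.1) inferInstance := by
    change borel (Policy U Q) = _
    rw [BorelSpace.measurable_eq (α := ProbabilityMeasure (U × Y))]
    exact borel_comap
  refine MeasurableEmbedding.standardBorelSpace (f := fun γ : Policy U Q => γ.1) ?_
  refine MeasurableEmbedding.iff_comap_eq.2 ⟨Subtype.val_injective, hcomap.symm, ?_⟩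
  have : MeasurableSet ((fun P : ProbabilityMeasure (U × Y) =>
      P.map measurable_snd.aemeasurable) ⁻¹' {Q}) :=
    measurable_probabilityMeasure_map measurable_snd (measurableSet_singleton Q)
  convert! this using 1
  ext P
  rw [mem_preimage, mem_singleton_iff, ← mem_youngMeasures_iff]
  exact ⟨fun ⟨γ, hγ⟩ => hγ ▸ γ.2, fun hP => ⟨⟨P, hP⟩, rfl⟩⟩

end StandardBorel

/-! ### De Finetti's theorem for sequences in a standard Borel space. -/

section DeFinetti

open Filter Topology

variable {X : Type*}

/-- The shift on sequences. -/
def seqTail (x : ℕ → X) : ℕ → X := fun i => x (i + 1)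

theorem seqTail_iterate (n : ℕ) (x : ℕ → X) (i : ℕ) : seqTail^[n] x i = x (i + n) := by
  induction n generalizing x with
  | zero => rfl
  | succ n ih => rw [Function.iterate_succ_apply, ih]; rfl

variable [MeasurableSpace X]

theorem measurable_reindex (s : ℕ → ℕ) : Measurable fun (x : ℕ → X) i => x (s i) :=
  measurable_pi_iff.2 fun i => measurable_pi_apply (s i)

theorem measurableSet_forall_lt (n : ℕ) {A : ℕ → Set X} (hA : ∀ i, MeasurableSet (A i)) :
    MeasurableSet {x : ℕ → X | ∀ i < n, x i ∈ A i} := by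
  simp only [Set.ofPred_forall]
  exact .iInter fun i => .iInter fun _ => measurable_pi_apply i (hA i)

/-- Finite-dimensional events see only finitely many indices, so there an injection can be replaced
by a permutation of an initial segment containing `I` and its image. -/
theorem exists_perm_extending_injective {s : ℕ → ℕ} (hs : Function.Injective s) (I : Finset ℕ) :
    ∃ (M : ℕ) (σ : Equiv.Perm (Fin M)), ∀ i ∈ I, ∃ h : i < M, (σ ⟨i, h⟩ : ℕ) = s i := by
  let M := (I ∪ I.image s).sup id + 1
  have hM : ∀ j ∈ I ∪ I.image s, j < M := fun j hj =>
    Nat.lt_succ_of_le (Finset.le_sup (f := id) hj)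
  obtain ⟨g, hg⟩ := Finset.exists_equiv_extend_of_card_eq (α := Fin M) (t := Finset.range M)
    (by simp) (s := Finset.univ.filter fun i : Fin M => (i : ℕ) ∈ I) (f := fun i => s i)
    (by
      intro j hj
      obtain ⟨i, hi, rfl⟩ := Finset.mem_image.1 hj
      exact Finset.mem_range.2 (hM _ (Finset.mem_union_right _
        (Finset.mem_image_of_mem s (Finset.mem_filter.1 hi).2))))
    (fun i _ j _ hij => Fin.ext (hs hij))
  refine ⟨M, g.trans ((Equiv.subtypeEquivRight fun i => Finset.mem_range).trans
    Fin.equivSubtype.symm), fun i hi => ⟨hM i (Finset.mem_union_left _ hi), ?_⟩⟩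
  exact hg ⟨i, hM i (Finset.mem_union_left _ hi)⟩ (by simpa using hi)

/-- The law of an exchangeable sequence is invariant under all injective reindexings. -/
theorem map_reindex_eq_of_exchangeable {P : Measure (ℕ → X)} [IsProbabilityMeasure P]
    (hP : ∀ (N : ℕ) (σ : Equiv.Perm (Fin N)) (A : Fin N → Set X), (∀ i, MeasurableSet (A i)) →
      P {x | ∀ i : Fin N, x i ∈ A i} = P {x | ∀ i : Fin N, x (σ i) ∈ A i})
    {s : ℕ → ℕ} (hs : Function.Injective s) :
    P.map (fun x i => x (s i)) = P := by
  classical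
  have : IsProbabilityMeasure (P.map fun x i => x (s i)) :=
    Measure.isProbabilityMeasure_map (measurable_reindex s).aemeasurable
  refine ext_of_generate_finite _ (generateFrom_squareCylinders (α := fun _ : ℕ => X)).symm
    (isPiSystem_squareCylinders (fun _ => MeasurableSpace.isPiSystem_measurableSet)
      fun _ => MeasurableSet.univ) ?_ (by simp)
  rintro _ ⟨I, A, hA, rfl⟩
  have hA' : ∀ i, MeasurableSet (A i) := fun i => hA i (mem_univ i)
  rw [Measure.map_apply (measurable_reindex s)
    (MeasurableSet.pi I.countable_toSet fun i _ => hA' i)]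
  obtain ⟨M, σ, hσ⟩ := exists_perm_extending_injective hs I
  have key := hP M σ (fun i => if (i : ℕ) ∈ I then A i else univ) fun i => by
    split_ifs
    exacts [hA' _, MeasurableSet.univ]
  convert key.symm using 2
  · ext x
    simp only [mem_preimage, Set.mem_pi, mem_ofPred_eq]
    refine ⟨fun h i => ?_, fun h i hi => ?_⟩
    · split_ifs with hi
      · obtain ⟨_, h'⟩ := hσ i hi
        rw [h']
        exact h i hi
      · trivial
    · obtain ⟨hiM, h'⟩ := hσ i hi
      have := h ⟨i, hiM⟩
      rw [h'] at this
      simpa [Finset.mem_coe.1 hi] using this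
  · ext x
    simp only [Set.mem_pi, mem_ofPred_eq]
    refine ⟨fun h i => ?_, fun h i hi => ?_⟩
    · split_ifs with hi
      exacts [h i hi, trivial]
    · obtain ⟨hiM, -⟩ := hσ i hi
      simpa [Finset.mem_coe.1 hi] using h ⟨i, hiM⟩

theorem measurable_seqTail : Measurable (seqTail : (ℕ → X) → ℕ → X) :=
  measurable_reindex Nat.succ

theorem measurePreserving_seqTail
    {P : Measure (ℕ → X)}
    (hP : ∀ s : ℕ → ℕ, Function.Injective s → P.map (fun x i => x (s i)) = P) :
    MeasurePreserving seqTail P P :=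
  ⟨measurable_seqTail, hP Nat.succ Nat.succ_injective⟩

variable [StandardBorelSpace X] [Nonempty X]

/-- The conditional law of the first term of a sequence given the subsequent ones. -/
noncomputable def headKernel (P : Measure (ℕ → X)) [IsFiniteMeasure P] : Kernel (ℕ → X) X :=
  (P.map fun x => (seqTail x, x 0)).condKernel

instance (P : Measure (ℕ → X)) [IsFiniteMeasure P] : IsMarkovKernel (headKernel P) := by
  unfold headKernel
  infer_instance

variable {P : Measure (ℕ → X)} [IsProbabilityMeasure P]

theorem measurable_headKernel {A : Set X} (hA : MeasurableSet A) :
    Measurable fun w => headKernel P w A :=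
  (headKernel P).measurable_coe hA

/-- The tail itself has law `P`, so the disintegration of (tail, head) has base measure `P`. -/
theorem setLIntegral_seqTail
    (hP : ∀ s : ℕ → ℕ, Function.Injective s → P.map (fun x i => x (s i)) = P)
    {A : Set X} (hA : MeasurableSet A) {f : (ℕ → X) → ℝ≥0∞} (hf : Measurable f) :
    ∫⁻ x in {x | x 0 ∈ A}, f (seqTail x) ∂P = ∫⁻ w, headKernel P w A * f w ∂P := by
  have hpair : Measurable fun x : ℕ → X => (seqTail x, x 0) :=
    measurable_seqTail.prodMk (measurable_pi_apply 0)
  have hfst : (P.map fun x => (seqTail x, x 0)).fst = P := by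
    rw [Measure.fst, Measure.map_map measurable_fst hpair]
    exact hP Nat.succ Nat.succ_injective
  have hdis : P ⊗ₘ headKernel P = P.map fun x => (seqTail x, x 0) := by
    have := (P.map fun x => (seqTail x, x 0)).disintegrate
      (P.map fun x => (seqTail x, x 0)).condKernel
    rwa [hfst] at this
  have hS : MeasurableSet {x : ℕ → X | x 0 ∈ A} := measurable_pi_apply 0 hA
  have hmeas : (P.restrict {x | x 0 ∈ A}).map seqTail =
      P.withDensity fun w => headKernel P w A := by
    ext E hE
    rw [Measure.map_apply measurable_seqTail hE, withDensity_apply _ hE,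
      Measure.restrict_apply (measurable_seqTail hE), ← Measure.compProd_apply_prod hE hA, hdis,
      Measure.map_apply hpair (hE.prod hA)]
    rfl
  rw [← lintegral_map hf measurable_seqTail, hmeas,
    lintegral_withDensity_eq_lintegral_mul _ (measurable_headKernel hA) hf]
  rfl

/-- With `h` the conditional probability of `A` and `T` the shift, `E[h · h∘T] = E[h²] = E[(h∘T)²]`,
hence `E[(h∘T - h)²] = 0`. -/
theorem headKernel_seqTail
    (hP : ∀ s : ℕ → ℕ, Function.Injective s → P.map (fun x i => x (s i)) = P)
    {A : Set X} (hA : MeasurableSet A) :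
    ∀ᵐ w ∂P, headKernel P (seqTail w) A = headKernel P w A := by
  have hm := measurable_headKernel (P := P) hA
  have hmT : Measurable fun w => headKernel P (seqTail w) A := hm.comp measurable_seqTail
  have hS : MeasurableSet {x : ℕ → X | x 0 ∈ A} := measurable_pi_apply 0 hA
  have hcross : ∫⁻ w, headKernel P w A * headKernel P (seqTail w) A ∂P =
      ∫⁻ w, headKernel P w A * headKernel P w A ∂P := by
    rw [← setLIntegral_seqTail hP hA hmT, ← setLIntegral_seqTail hP hA hm]
    -- Dropping the second term keeps the head and shifts the tail once; this equates the two
    -- integrals over `x 0 ∈ A`.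
    let s : ℕ → ℕ := fun i => if i = 0 then 0 else i + 1
    have hs : Function.Injective s := fun i j hij => by grind
    have hpres : MeasurePreserving (fun (x : ℕ → X) i => x (s i)) P P :=
      ⟨measurable_reindex s, hP s hs⟩
    exact hpres.setLIntegral_comp_preimage hS (hm.comp measurable_seqTail)
  have hsq : ∫⁻ w, headKernel P (seqTail w) A * headKernel P (seqTail w) A ∂P =
      ∫⁻ w, headKernel P w A * headKernel P w A ∂P :=
    (measurePreserving_seqTail hP).lintegral_comp (hm.mul hm)
  let h : (ℕ → X) → ℝ := fun w => (headKernel P w).real A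
  have hh : Measurable h := hm.ennreal_toReal
  have hint : ∀ f g : (ℕ → X) → (ℕ → X), Measurable f → Measurable g →
      Integrable (fun w => h (f w) * h (g w)) P ∧
      ∫ w, h (f w) * h (g w) ∂P =
        (∫⁻ w, headKernel P (f w) A * headKernel P (g w) A ∂P).toReal := by
    intro f g hf hg
    refine ⟨Integrable.of_bound (C := 1)
      ((hh.comp hf).mul (hh.comp hg)).aestronglyMeasurable (ae_of_all _ fun w => ?_), ?_⟩
    · rw [Real.norm_of_nonneg (mul_nonneg measureReal_nonneg measureReal_nonneg)]
      exact mul_le_one₀ measureReal_le_one measureReal_nonneg measureReal_le_one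
    · have hfg : Measurable fun w => headKernel P (f w) A * headKernel P (g w) A :=
        (hm.comp hf).mul (hm.comp hg)
      rw [← integral_toReal hfg.aemeasurable
        (ae_of_all _ fun w => ENNReal.mul_lt_top (measure_lt_top _ _) (measure_lt_top _ _))]
      simp only [ENNReal.toReal_mul]
      rfl
  obtain ⟨i1, e1⟩ := hint id id measurable_id measurable_id
  obtain ⟨i2, e2⟩ := hint id seqTail measurable_id measurable_seqTail
  obtain ⟨i3, e3⟩ := hint seqTail seqTail measurable_seqTail measurable_seqTail
  simp only [id] at i1 i2 e1 e2
  have i31 : Integrable (fun w => h (seqTail w) * h (seqTail w) + h w * h w) P := i3.add i1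
  have hzero : ∫ w, (h (seqTail w) - h w) ^ 2 ∂P = 0 := by
    have : ∀ w, (h (seqTail w) - h w) ^ 2 =
        h (seqTail w) * h (seqTail w) + h w * h w - 2 * (h w * h (seqTail w)) := fun w => by ring
    simp_rw [this]
    rw [integral_sub i31 (i2.const_mul 2), integral_add i3 i1, integral_const_mul,
      e1, e2, e3, hcross, hsq]
    ring
  have hintsq : Integrable (fun w => (h (seqTail w) - h w) ^ 2) P := by
    refine (i31.sub (i2.const_mul 2)).congr (ae_of_all _ fun w => ?_)
    simp only [Pi.sub_apply]
    ring
  filter_upwards [(integral_eq_zero_iff_of_nonneg (fun w => sq_nonneg _) hintsq).1 hzero] with w hw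
  have : h (seqTail w) = h w := sub_eq_zero.1 (pow_eq_zero_iff two_ne_zero |>.1 hw)
  exact (ENNReal.toReal_eq_toReal_iff' (measure_ne_top _ _) (measure_ne_top _ _)).1 this

theorem headKernel_seqTail_iterate
    (hP : ∀ s : ℕ → ℕ, Function.Injective s → P.map (fun x i => x (s i)) = P)
    {A : Set X} (hA : MeasurableSet A) (n : ℕ) :
    ∀ᵐ w ∂P, headKernel P (seqTail^[n] w) A = headKernel P w A := by
  induction n with
  | zero => exact ae_of_all _ fun _ => rfl
  | succ n ih =>
    filter_upwards [(measurePreserving_seqTail hP).quasiMeasurePreserving.ae ih,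
      headKernel_seqTail hP hA] with w h1 h2
    rw [Function.iterate_succ_apply, h1, h2]

theorem setLIntegral_seqTail_iterate
    (hP : ∀ s : ℕ → ℕ, Function.Injective s → P.map (fun x i => x (s i)) = P)
    (n : ℕ) {A : ℕ → Set X} (hA : ∀ i, MeasurableSet (A i))
    {f : (ℕ → X) → ℝ≥0∞} (hf : Measurable f) :
    ∫⁻ x in {x | ∀ i < n, x i ∈ A i}, f (seqTail^[n] x) ∂P =
      ∫⁻ w, (∏ i ∈ Finset.range n, headKernel P w (A i)) * f w ∂P := by
  induction n generalizing A f with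
  | zero => simp
  | succ n ih =>
    let S : Set (ℕ → X) := {x | ∀ i < n, x i ∈ A (i + 1)}
    have hS : MeasurableSet S := measurableSet_forall_lt n fun i => hA (i + 1)
    have hfn : Measurable fun x => f (seqTail^[n] x) := hf.comp (measurable_seqTail.iterate n)
    have hset : {x : ℕ → X | ∀ i < n + 1, x i ∈ A i} = {x | x 0 ∈ A 0} ∩ seqTail ⁻¹' S := by
      ext x
      refine ⟨fun h => ⟨h 0 n.succ_pos, fun i hi => h (i + 1) (Nat.succ_lt_succ hi)⟩, ?_⟩
      rintro ⟨h0, h⟩ (_ | i) hi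
      exacts [h0, h i (Nat.lt_of_succ_lt_succ hi)]
    calc ∫⁻ x in {x | ∀ i < n + 1, x i ∈ A i}, f (seqTail^[n + 1] x) ∂P
        = ∫⁻ x in {x | x 0 ∈ A 0}, S.indicator (fun x => f (seqTail^[n] x)) (seqTail x) ∂P := by
          rw [hset, inter_comm, ← Measure.restrict_restrict (measurable_seqTail hS),
            ← lintegral_indicator (measurable_seqTail hS)]
          rfl
      _ = ∫⁻ w, headKernel P w (A 0) * S.indicator (fun x => f (seqTail^[n] x)) w ∂P :=
          setLIntegral_seqTail hP (hA 0) (hfn.indicator hS)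
      _ = ∫⁻ w in S, headKernel P w (A 0) * f (seqTail^[n] w) ∂P := by
          rw [← lintegral_indicator hS]
          refine lintegral_congr fun w => ?_
          by_cases hw : w ∈ S <;> simp [hw]
      -- Shift invariance turns the factor of the removed head into a function of the `n`-fold tail,
      -- as the induction hypothesis requires.
      _ = ∫⁻ w in S, headKernel P (seqTail^[n] w) (A 0) * f (seqTail^[n] w) ∂P := by
          refine lintegral_congr_ae (ae_restrict_of_ae ?_)
          filter_upwards [headKernel_seqTail_iterate hP (hA 0) n] with w hw
          rw [hw]
      _ = _ := by
          rw [ih (fun i => hA (i + 1)) (f := fun w => headKernel P w (A 0) * f w)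
            ((measurable_headKernel (hA 0)).mul hf)]
          refine lintegral_congr fun w => ?_
          rw [Finset.prod_range_succ', mul_assoc]

/-- Given the odd terms of an exchangeable sequence, the even terms are independent with common
law the head kernel evaluated at the odd terms. -/
theorem measure_even_odd
    (hP : ∀ s : ℕ → ℕ, Function.Injective s → P.map (fun x i => x (s i)) = P)
    {C : Set (ℕ → X)} (hC : MeasurableSet C) {A : ℕ → Set X} (hA : ∀ i, MeasurableSet (A i)) :
    P {x | (fun i => x (2 * i + 1)) ∈ C ∧ ∀ i, x (2 * i) ∈ A i} =
      ∫⁻ w in C, ∏' i, headKernel P w (A i) ∂P := by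
  have hmC : MeasurableSet {x : ℕ → X | (fun i => x (2 * i + 1)) ∈ C} :=
    measurable_reindex (fun i => 2 * i + 1) hC
  have hmeas : ∀ n, MeasurableSet
      {x : ℕ → X | (fun i => x (2 * i + 1)) ∈ C ∧ ∀ i < n, x (2 * i) ∈ A i} := fun n =>
    hmC.inter (measurable_reindex (fun i => 2 * i) (measurableSet_forall_lt n hA))
  have hfin : ∀ n, P {x | (fun i => x (2 * i + 1)) ∈ C ∧ ∀ i < n, x (2 * i) ∈ A i} =
      ∫⁻ w in C, ∏ i ∈ Finset.range n, headKernel P w (A i) ∂P := by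
    intro n
    -- The first `n` even terms are put in front of all odd terms; the remaining even terms are
    -- discarded.
    let r : ℕ → ℕ := fun i => if i < n then 2 * i else 2 * (i - n) + 1
    have hr : Function.Injective r := fun i j hij => by grind
    let S : Set (ℕ → X) := {x | ∀ i < n, x i ∈ A i}
    have hS : MeasurableSet S := measurableSet_forall_lt n hA
    have hCn : MeasurableSet (seqTail^[n] ⁻¹' C) := measurable_seqTail.iterate n hC
    have h1 := setLIntegral_seqTail_iterate hP n hA (f := C.indicator 1)
      (measurable_one.indicator hC)
    have h2 : ∫⁻ x in S, C.indicator 1 (seqTail^[n] x) ∂P = P (seqTail^[n] ⁻¹' C ∩ S) := by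
      rw [← Measure.restrict_apply hCn, ← lintegral_indicator_one hCn]
      rfl
    have h3 : P (seqTail^[n] ⁻¹' C ∩ S) =
        P {x | (fun i => x (2 * i + 1)) ∈ C ∧ ∀ i < n, x (2 * i) ∈ A i} := by
      conv_lhs => rw [← hP r hr]
      rw [Measure.map_apply (measurable_reindex r) (hCn.inter hS)]
      congr 1
      ext x
      have e1 : seqTail^[n] (fun i => x (r i)) = fun i => x (2 * i + 1) := by
        ext i
        simp [seqTail_iterate, r]
      simp only [mem_preimage, mem_inter_iff, e1, S, mem_ofPred_eq]
      refine and_congr_right fun _ => forall₂_congr fun i hi => ?_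
      simp [r, hi]
    rw [← h3, ← h2, h1, ← lintegral_indicator hC]
    refine lintegral_congr fun w => ?_
    by_cases hw : w ∈ C <;> simp [hw]
  have hset : {x : ℕ → X | (fun i => x (2 * i + 1)) ∈ C ∧ ∀ i, x (2 * i) ∈ A i} =
      ⋂ n, {x | (fun i => x (2 * i + 1)) ∈ C ∧ ∀ i < n, x (2 * i) ∈ A i} := by
    ext x
    simp only [mem_iInter, mem_ofPred_eq]
    exact ⟨fun h n => ⟨h.1, fun i _ => h.2 i⟩, fun h => ⟨(h 0).1, fun i => (h (i + 1)).2 i (by simp)⟩⟩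
  have hlim1 : Tendsto (fun n => P {x | (fun i => x (2 * i + 1)) ∈ C ∧ ∀ i < n, x (2 * i) ∈ A i})
      atTop (𝓝 (P {x | (fun i => x (2 * i + 1)) ∈ C ∧ ∀ i, x (2 * i) ∈ A i})) := by
    rw [hset]
    refine tendsto_measure_iInter_atTop (fun n => (hmeas n).nullMeasurableSet) ?_
      ⟨0, measure_ne_top _ _⟩
    exact fun n m hnm x hx => ⟨hx.1, fun i hi => hx.2 i (hi.trans_le hnm)⟩
  simp_rw [hfin] at hlim1
  refine tendsto_nhds_unique hlim1 ?_
  refine tendsto_lintegral_of_dominated_convergence (fun _ => 1)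
    (fun n => Finset.measurable_prod _ fun i _ => measurable_headKernel (hA i))
    (fun n => ae_of_all _ fun w => Finset.prod_le_one' fun i _ => prob_le_one) (by simp)
    (ae_of_all _ fun w => ?_)
  exact (multipliable_of_forall_le_one _ fun i => prob_le_one).hasProd.tendsto_prod_nat

/-- De Finetti's theorem in a standard Borel space, with a directing random variable that takes
values in the unit interval. -/
theorem exists_directing_randomness
    (hP : ∀ s : ℕ → ℕ, Function.Injective s → P.map (fun x i => x (s i)) = P) :
    ∃ (Z : (ℕ → X) → Icc (0 : ℝ) 1) (κ : Kernel (Icc (0 : ℝ) 1) X),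
      Measurable Z ∧ IsMarkovKernel κ ∧
      ∀ (B : Set (Icc (0 : ℝ) 1)) (A : ℕ → Set X), MeasurableSet B → (∀ i, MeasurableSet (A i)) →
        P {x | Z x ∈ B ∧ ∀ i, x (2 * i) ∈ A i} =
          ∫⁻ z in B, ∏' i, κ z (A i) ∂(P.map Z) := by
  have he := measurableEmbedding_sigmoid_comp_embeddingReal (ℕ → X)
  let e : (ℕ → X) → Icc (0 : ℝ) 1 := unitInterval.sigmoid ∘ embeddingReal (ℕ → X)
  have hodd : Function.Injective fun i : ℕ => 2 * i + 1 := fun i j hij => by grind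
  -- The kernel decodes a point of `[0, 1]` to a sequence and applies the head kernel there.
  let κ := (headKernel P).comap he.invFun he.measurable_invFun
  refine ⟨fun x => e fun i => x (2 * i + 1), κ,
    he.measurable.comp (measurable_reindex _), inferInstance, fun B A hB hA => ?_⟩
  have hmap : P.map (fun x => e fun i => x (2 * i + 1)) = P.map e := by
    conv_rhs => rw [← hP _ hodd]
    rw [Measure.map_map he.measurable (measurable_reindex _)]
    rfl
  have hmeas : Measurable fun z => ∏' i, κ z (A i) :=
    measurable_of_tendsto_metrizable
      (fun n => Finset.measurable_prod (Finset.range n) fun i _ => κ.measurable_coe (hA i))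
      (tendsto_pi_nhds.2 fun z =>
        (multipliable_of_forall_le_one _ fun i => prob_le_one).hasProd.tendsto_prod_nat)
  rw [hmap, setLIntegral_map hB hmeas he.measurable]
  refine (measure_even_odd hP (he.measurable hB) hA).trans (lintegral_congr fun w => ?_)
  simp only [κ, Kernel.comap_apply, he.leftInverse_invFun w]

end DeFinetti

/-! ### The theorem for team policies. -/

theorem mainTheorem3 {U : Type u} {Y : Type v}
    [TopologicalSpace U] [TopologicalSpace.MetrizableSpace U] [SecondCountableTopology U]
    [MeasurableSpace U] [BorelSpace U] [StandardBorelSpace U]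
    [TopologicalSpace Y] [TopologicalSpace.MetrizableSpace Y] [SecondCountableTopology Y]
    [MeasurableSpace Y] [BorelSpace Y] [StandardBorelSpace Y]
    (Q : ProbabilityMeasure Y) (P : RandomizedPolicy U Q) (hP : P ∈ exchangeablePolicies U Q) :
    P ∈ commonSymmetricPolicies U Q ∧
    -- the common randomness as a random variable `Z`, jointly with policies `g` of law `P`
    ∃ (Ω : Type (max u v)) (_ : MeasurableSpace Ω) (μ : Measure Ω) (Z : Ω → Icc (0 : ℝ) 1)
      (g : Ω → ℕ → Policy U Q) (κ : Kernel (Icc (0 : ℝ) 1) (Policy U Q)),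
      IsProbabilityMeasure μ ∧ Measurable Z ∧ Measurable g ∧ IsMarkovKernel κ ∧
      μ.map g = (P : Measure (ℕ → Policy U Q)) ∧
      ∀ (B : Set (Icc (0 : ℝ) 1)) (A : ℕ → Set (Policy U Q)),
        MeasurableSet B → (∀ i, MeasurableSet (A i)) →
          μ {ω | Z ω ∈ B ∧ ∀ i, g ω i ∈ A i} = ∫⁻ z in B, ∏' i, κ z (A i) ∂(μ.map Z) := by
  have hne : Nonempty (Policy U Q) := P.nonempty.map fun γ => γ 0
  have := policy_standardBorelSpace (U := U) Q
  have hinv : ∀ s : ℕ → ℕ, Function.Injective s →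
      (P : Measure (ℕ → Policy U Q)).map (fun x i => x (s i)) = P := fun s hs =>
    map_reindex_eq_of_exchangeable hP hs
  obtain ⟨Z, κ, hZ, hκ, hjoint⟩ := exists_directing_randomness hinv
  have heven : Function.Injective fun i : ℕ => 2 * i := fun i j hij => by grind
  -- The sample space is the sequence space under `P`, with the even terms as `g`; by reindexing
  -- invariance `g` has law `P`.
  refine ⟨⟨P.map hZ.aemeasurable, κ, hκ, fun A hA => ?_⟩,
    ℕ → Policy U Q, inferInstance, P, Z, fun x i => x (2 * i), κ, inferInstance, hZ,
    measurable_reindex _, hκ, hinv _ heven, hjoint⟩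
  have h := hjoint univ A MeasurableSet.univ hA
  simp only [mem_univ, true_and, Measure.restrict_univ] at h
  refine Eq.trans ?_ h
  have hmeas : MeasurableSet {γ : ℕ → Policy U Q | ∀ i, γ i ∈ A i} := by
    simp only [Set.ofPred_forall]
    exact .iInter fun i => measurable_pi_apply i (hA i)
  conv_lhs => rw [← hinv _ heven]
  exact Measure.map_apply (measurable_reindex _) hmeas
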